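/- Let $G$ be an arbitrary group. A set $A\subseteq G$ is called large if $FA=G$ for some finite $F\subseteq G$, and small if $B\setminus A$ is large for every large $B\subseteq G$. The family $\mathcal S$ of all small subsets of $G$ is a translation-invariant ideal, that is, $\emptyset\in\mathcal S$, $\mathcal S\neq\mathcal P(G)$, $\mathcal S$ is closed under taking subsets and finite unions, and $xA\in\mathcal S$ for all $x\in G$, $A\in\mathcal S$. Moreover, there is a topology $\tau_s$ on $G$ that is Hausdorff, extremally disconnected (the closure of every open set is open) and left-invariant ($xU\in\tau_s$ for all $x\in G$, $U\in\tau_s$), such that $\mathcal S$ coincides with the ideal of nowhere dense subsets of $(G,\tau_s)$. -/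

import Mathlib

open scoped Pointwise

/-- A subset `A` of a group is large if `F A = G` for some finite `F ⊆ G`. -/
def IsLarge {G : Type*} [Group G] (A : Set G) : Prop :=
  ∃ F : Set G, F.Finite ∧ F * A = Set.univ

/-- A subset `A` of a group is small if removing it from any large set leaves a large set. -/
def IsSmall {G : Type*} [Group G] (A : Set G) : Prop :=
  ∀ B : Set G, IsLarge B → IsLarge (B \ A)

/-- The family of all small subsets of `G`. -/
def smallSets (G : Type*) [Group G] : Set (Set G) :=
  {A | IsSmall A}

/-- A proper, nonempty family of subsets of a group, closed under taking subsets, finite unions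
and left translates. -/
structure IsInvariantIdeal {G : Type*} [Group G] (I : Set (Set G)) : Prop where
  ne_univ : I ≠ Set.univ
  empty_mem : ∅ ∈ I
  subset_mem : ∀ ⦃A B : Set G⦄, B ∈ I → A ⊆ B → A ∈ I
  union_mem : ∀ ⦃A B : Set G⦄, A ∈ I → B ∈ I → A ∪ B ∈ I
  smul_mem : ∀ (x : G) ⦃A : Set G⦄, A ∈ I → x • A ∈ I

/-- A topology on a group is left-invariant if left translates of open sets are open. -/
def IsLeftInvariantTopology {G : Type*} [Group G] (τ : TopologicalSpace G) : Prop :=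
  ∀ (x : G) (U : Set G), @IsOpen G τ U → @IsOpen G τ (x • U)

open Filter

section LargeSmall

variable {G : Type*} [Group G] {A B : Set G}

/-! The ideal axioms are formal. For the topology, a set is small iff it belongs to no ultrafilter
in any minimal closed left ideal of `Ultrafilter G` (`isSmall_iff_forall_notMem`). Pick a family `E`
from these ideals, meeting each of them, with `e * f = f` on `E` (`exists_leftIdentity_family`), and
let `U` be open when `U ∈ x * f` for all `x ∈ U`, `f ∈ E`. Then each `{x | A ∈ x * f}` is clopen and
is the closure of `A` if `A` is open; nowhere density means all these sets are empty. -/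

theorem IsLarge.mono (hA : IsLarge A) (h : A ⊆ B) : IsLarge B := by
  obtain ⟨F, hF, hFA⟩ := hA
  exact ⟨F, hF, Set.eq_univ_of_univ_subset (hFA ▸ Set.mul_subset_mul_left h)⟩

theorem isLarge_univ : IsLarge (Set.univ : Set G) :=
  ⟨{1}, Set.finite_singleton 1, by simp⟩

theorem not_isLarge_empty : ¬ IsLarge (∅ : Set G) := by
  rintro ⟨F, -, hF⟩
  rw [Set.mul_empty] at hF
  exact Set.empty_ne_univ hF

theorem IsLarge.smul (hA : IsLarge A) (x : G) : IsLarge (x • A) := by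
  obtain ⟨F, hF, hFA⟩ := hA
  refine ⟨F * {x⁻¹}, hF.mul (Set.finite_singleton _), ?_⟩
  rw [mul_assoc, Set.singleton_mul]
  change F * (x⁻¹ • x • A) = Set.univ
  rw [inv_smul_smul, hFA]

theorem isSmall_empty : IsSmall (∅ : Set G) := fun B hB => by rwa [Set.sdiff_empty]

theorem not_isSmall_univ : ¬ IsSmall (Set.univ : Set G) := fun h =>
  not_isLarge_empty (by simpa using h _ isLarge_univ)

theorem IsSmall.subset (hB : IsSmall B) (h : A ⊆ B) : IsSmall A := fun _ hC =>
  (hB _ hC).mono (Set.sdiff_subset_sdiff_right h)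

theorem IsSmall.union (hA : IsSmall A) (hB : IsSmall B) : IsSmall (A ∪ B) := fun C hC => by
  rw [← Set.sdiff_sdiff]
  exact hB _ (hA _ hC)

theorem IsSmall.smul (hA : IsSmall A) (x : G) : IsSmall (x • A) := fun B hB => by
  have h := (hA _ (hB.smul x⁻¹)).smul x
  rwa [Set.smul_set_sdiff, smul_inv_smul] at h

theorem isSmall_biUnion_smul (hA : IsSmall A) (t : Finset G) :
    IsSmall (⋃ x ∈ t, x • A) := by
  classical
  induction t using Finset.induction_on with
  | empty => simpa using isSmall_empty
  | insert x t _ ih =>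
    rw [Finset.set_biUnion_insert]
    exact (hA.smul x).union ih

theorem isInvariantIdeal_smallSets (G : Type*) [Group G] : IsInvariantIdeal (smallSets G) where
  ne_univ h := not_isSmall_univ (h.symm ▸ Set.mem_univ _ : Set.univ ∈ smallSets G)
  empty_mem := isSmall_empty
  subset_mem _ _ hB h := IsSmall.subset hB h
  union_mem _ _ hA hB := IsSmall.union hA hB
  smul_mem x _ hA := IsSmall.smul hA x

/-- A large set has a translate in every ultrafilter. -/
theorem IsLarge.exists_eventually_mul_mem (hA : IsLarge A) (f : Ultrafilter G) :
    ∃ x : G, ∀ᶠ m in f, x * m ∈ A := by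
  obtain ⟨F, hF, hFA⟩ := hA
  have h : (⋃ x ∈ F, {m | x⁻¹ * m ∈ A}) ∈ f := by
    refine mem_of_superset univ_mem fun m _ => ?_
    obtain ⟨x, hx, a, ha, rfl⟩ := Set.mem_mul.1 (hFA ▸ Set.mem_univ m : m ∈ F * A)
    exact Set.mem_biUnion hx (by simpa using ha)
  obtain ⟨x, -, hx⟩ := (Ultrafilter.finite_biUnion_mem_iff hF).1 h
  exact ⟨x⁻¹, hx⟩

end LargeSmall

/-! ### Topologies defined by families of ultrafilters -/

section Translate

variable {G : Type*} [Group G]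

/-- The elements `x` such that `A` belongs to the translate of `f` by `x`. -/
def ultrafilterShift (f : Ultrafilter G) (A : Set G) : Set G :=
  {x | ∀ᶠ m in f, x * m ∈ A}

/-- A maximal `A` disjoint from `z • A` covers `G` together with its translates by `z` and `z⁻¹`, so
`f` contains one of the three. This separates `x * f` from `y * f`. -/
theorem exists_mem_ultrafilter_forall_mul_notMem (f : Ultrafilter G) {z : G} (hz : z ≠ 1) :
    ∃ B ∈ f, ∀ b ∈ B, z * b ∉ B := by
  obtain ⟨A, hA⟩ := zorn_subset {A : Set G | ∀ a ∈ A, z * a ∉ A} fun c hc hchain =>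
    ⟨⋃₀ c, by
      rintro a ⟨s, hs, has⟩ ⟨t, ht, hat⟩
      rcases hchain.total hs ht with h | h
      · exact hc ht a (h has) hat
      · exact hc hs a has (h hat), fun s hs => Set.subset_sUnion_of_mem hs⟩
  have hprop : ∀ a ∈ A, z * a ∉ A := hA.prop
  have hcover : ∀ y, y ∈ A ∨ z * y ∈ A ∨ z⁻¹ * y ∈ A := by
    intro y
    by_contra! h
    obtain ⟨h1, h2, h3⟩ := h
    refine h1 (hA.le_of_ge (y := insert y A) ?_ (Set.subset_insert y A) (Set.mem_insert y A))
    rintro a (rfl | ha) (h | h)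
    · exact hz (mul_eq_right.1 h)
    · exact h2 h
    · exact h3 (by rwa [← h, inv_mul_cancel_left])
    · exact hprop a ha h
  have hmem : ∀ᶠ y in (f : Filter G), y ∈ A ∨ z * y ∈ A ∨ z⁻¹ * y ∈ A :=
    Eventually.of_forall hcover
  rw [Ultrafilter.eventually_or, Ultrafilter.eventually_or] at hmem
  rcases hmem with h | h | h
  · exact ⟨A, h, hprop⟩
  · exact ⟨_, h, fun b hb => hprop _ hb⟩
  · refine ⟨_, h, fun b hb hb' => hprop _ hb ?_⟩
    simpa using hb'

theorem exists_mem_ultrafilterShift_notMem (f : Ultrafilter G) {x y : G} (h : x ≠ y) :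
    ∃ A, x ∈ ultrafilterShift f A ∧ y ∉ ultrafilterShift f A := by
  obtain ⟨B, hB, hBz⟩ := exists_mem_ultrafilter_forall_mul_notMem f
    (z := x⁻¹ * y) (fun h' => h (inv_mul_eq_one.1 h'))
  refine ⟨{m | x⁻¹ * m ∈ B}, ?_, fun hy => ?_⟩
  · change ∀ᶠ m in (f : Filter G), x⁻¹ * (x * m) ∈ B
    simpa using hB
  · have hy' : ∀ᶠ m in (f : Filter G), x⁻¹ * (y * m) ∈ B := hy
    obtain ⟨m, hm, hm'⟩ := (hy'.and hB).exists
    exact hBz m hm' (by rwa [mul_assoc])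

theorem ultrafilterShift_compl (f : Ultrafilter G) (A : Set G) :
    ultrafilterShift f Aᶜ = (ultrafilterShift f A)ᶜ :=
  Set.ext fun _ => Ultrafilter.eventually_not

/-- The topology in which `U` is open if, for each `x ∈ U`, the translates by `x` of all
ultrafilters in `E` contain `U`. -/
@[reducible]
def ultrafilterTopology (E : Set (Ultrafilter G)) : TopologicalSpace G where
  IsOpen U := ∀ f ∈ E, U ⊆ ultrafilterShift f U
  isOpen_univ _ _ _ _ := Eventually.of_forall fun _ => trivial
  isOpen_inter _ _ hU hV f hf _ hx := (hU f hf hx.1).and (hV f hf hx.2)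
  isOpen_sUnion s hs f hf x := by
    rintro ⟨U, hU, hx⟩
    exact (hs U hU f hf hx).mono fun _ hm => ⟨U, hU, hm⟩

theorem isLeftInvariantTopology_ultrafilterTopology (E : Set (Ultrafilter G)) :
    IsLeftInvariantTopology (ultrafilterTopology E) := by
  rintro x U hU f hf _ ⟨u, hu, rfl⟩
  exact (hU f hf hu).mono fun m hm => ⟨u * m, hm, by simp [mul_assoc]⟩

attribute [local instance] Ultrafilter.semigroup

variable {E : Set (Ultrafilter G)}

/-- Openness is `e * f = f` unfolded; closedness follows since shifts commute with complements. -/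
theorem isClopen_ultrafilterShift (hE : ∀ e ∈ E, ∀ f ∈ E, e * f = f) {f : Ultrafilter G}
    (hf : f ∈ E) (A : Set G) : @IsClopen G (ultrafilterTopology E) (ultrafilterShift f A) := by
  let := ultrafilterTopology E
  have hopen : ∀ B, IsOpen (ultrafilterShift f B) := by
    intro B e he x hx
    have hx' : ∀ᶠ m in (f : Filter G), x * m ∈ B := hx
    rw [← hE e he f hf, Ultrafilter.eventually_mul] at hx'
    simpa only [ultrafilterShift, Set.mem_ofPred_eq, mul_assoc] using hx'
  exact ⟨⟨ultrafilterShift_compl f A ▸ hopen Aᶜ⟩, hopen A⟩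

theorem ultrafilterShift_subset_closure {f : Ultrafilter G} (hf : f ∈ E) (A : Set G) :
    ultrafilterShift f A ⊆ @closure G (ultrafilterTopology E) A := by
  let := ultrafilterTopology E
  intro x hx
  rw [mem_closure_iff]
  intro U hU hxU
  obtain ⟨m, hm⟩ := ((hU f hf hxU).and hx).exists
  exact ⟨_, hm⟩

theorem closure_eq_ultrafilterShift (hE : ∀ e ∈ E, ∀ f ∈ E, e * f = f) {f : Ultrafilter G}
    (hf : f ∈ E) {U : Set G} (hU : @IsOpen G (ultrafilterTopology E) U) :
    @closure G (ultrafilterTopology E) U = ultrafilterShift f U := by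
  let := ultrafilterTopology E
  exact (closure_minimal (hU f hf) (isClopen_ultrafilterShift hE hf U).isClosed).antisymm
    (ultrafilterShift_subset_closure hf U)

theorem t2Space_ultrafilterTopology (hE : ∀ e ∈ E, ∀ f ∈ E, e * f = f) (hne : E.Nonempty) :
    @T2Space G (ultrafilterTopology E) := by
  let := ultrafilterTopology E
  obtain ⟨f, hf⟩ := hne
  refine ⟨fun x y hxy => ?_⟩
  obtain ⟨A, hx, hy⟩ := exists_mem_ultrafilterShift_notMem f hxy
  have hA := isClopen_ultrafilterShift hE hf A
  exact ⟨_, _, hA.isOpen, hA.compl.isOpen, hx, hy, disjoint_compl_right⟩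

theorem extremallyDisconnected_ultrafilterTopology (hE : ∀ e ∈ E, ∀ f ∈ E, e * f = f)
    (hne : E.Nonempty) : @ExtremallyDisconnected G (ultrafilterTopology E) := by
  let := ultrafilterTopology E
  obtain ⟨f, hf⟩ := hne
  refine ⟨fun U hU => ?_⟩
  rw [closure_eq_ultrafilterShift hE hf hU]
  exact (isClopen_ultrafilterShift hE hf U).isOpen

theorem isNowhereDense_ultrafilterTopology_iff (hE : ∀ e ∈ E, ∀ f ∈ E, e * f = f)
    (hne : E.Nonempty) (A : Set G) :
    @IsNowhereDense G (ultrafilterTopology E) A ↔ ∀ f ∈ E, ultrafilterShift f A = ∅ := by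
  let := ultrafilterTopology E
  constructor
  · intro hA f hf
    exact Set.subset_eq_empty (interior_maximal (ultrafilterShift_subset_closure hf A)
      (isClopen_ultrafilterShift hE hf A).isOpen) hA
  · intro hA
    have hclosed : IsClosed A := by
      refine ⟨fun f hf x _ => ?_⟩
      rw [ultrafilterShift_compl, hA f hf]
      exact Set.notMem_empty x
    rw [IsNowhereDense, hclosed.closure_eq, Set.eq_empty_iff_forall_notMem]
    intro x hx
    obtain ⟨f, hf⟩ := hne
    have hxA : x ∈ ultrafilterShift f A :=
      Eventually.mono (isOpen_interior (s := A) f hf hx) fun _ hm => interior_subset hm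
    rwa [hA f hf] at hxA

/-- A minimal closed left ideal of the semigroup of ultrafilters on `G`. -/
structure IsMinimalLeftIdeal (L : Set (Ultrafilter G)) : Prop where
  isClosed : IsClosed L
  nonempty : L.Nonempty
  mul_mem : ∀ y, ∀ q ∈ L, y * q ∈ L
  exists_mul_eq : ∀ q ∈ L, ∀ r ∈ L, ∃ y, y * q = r

theorem exists_isMinimalLeftIdeal_subset {C : Set (Ultrafilter G)} (hC : IsClosed C)
    (hne : C.Nonempty) (hmul : ∀ y, ∀ q ∈ C, y * q ∈ C) :
    ∃ L ⊆ C, IsMinimalLeftIdeal L := by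
  obtain ⟨L, hLC, hL⟩ := zorn_superset_nonempty
    {L : Set (Ultrafilter G) | IsClosed L ∧ L.Nonempty ∧ ∀ y, ∀ q ∈ L, y * q ∈ L}
    (fun c hc hchain hcne => ⟨⋂₀ c, ⟨isClosed_sInter fun s hs => (hc hs).1,
      IsCompact.nonempty_sInter_of_directed_nonempty_isCompact_isClosed
        (hS := hcne.coe_sort) (IsChain.directedOn (r := fun s t : Set _ => s ⊇ t) hchain.symm) (fun s hs => (hc hs).2.1) (fun s hs => (hc hs).1.isCompact)
        (fun s hs => (hc hs).1),
      fun y q hq s hs => (hc hs).2.2 y q (hq s hs)⟩, fun s hs => Set.sInter_subset_of_mem hs⟩)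
    C ⟨hC, hne, hmul⟩
  obtain ⟨hcl, hLne, hLmul⟩ := hL.prop
  refine ⟨L, hLC, hcl, hLne, hLmul, fun q hq r hr => ?_⟩
  have hrange : Set.range (· * q) ⊆ L := by
    rintro _ ⟨y, rfl⟩
    exact hLmul y q hq
  -- The translates `y * q` form a closed left ideal inside `L`, hence all of `L`.
  refine Minimal.le_of_le hL (y := Set.range (· * q)) ⟨?_, ⟨q * q, q, rfl⟩, ?_⟩ hrange hr
  · exact (isCompact_range (Ultrafilter.continuous_mul_left q)).isClosed
  · rintro y _ ⟨z, rfl⟩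
    exact ⟨y * z, mul_assoc y z q⟩

theorem eventually_pure_mul (x : G) (f : Ultrafilter G) (p : G → Prop) :
    (∀ᶠ m in ((pure x * f : Ultrafilter G) : Filter G), p m) ↔ ∀ᶠ m in f, p (x * m) := by
  rw [Ultrafilter.eventually_mul]
  simp

/-- Small sets are exactly those missed by the minimal left ideals of ultrafilters. -/
theorem isSmall_iff_forall_notMem {A : Set G} :
    IsSmall A ↔ ∀ L : Set (Ultrafilter G), IsMinimalLeftIdeal L → ∀ q ∈ L, A ∉ q := by
  constructor
  · intro hA L hL q hq hAq
    -- By compactness, finitely many translates of `A` have a union in every member of `L`; being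
    -- small, this union has a large complement, a contradiction.
    have hcover : L ⊆ ⋃ x : G, {r : Ultrafilter G | x • A ∈ r} := by
      intro r hr
      obtain ⟨y, rfl⟩ := hL.exists_mul_eq r hr q hq
      have hy : ∀ᶠ m in (y : Filter G), ∀ᶠ m' in (r : Filter G), m * m' ∈ A := hAq
      obtain ⟨x, hx⟩ := hy.exists
      refine Set.mem_iUnion.2 ⟨x⁻¹, mem_of_superset hx fun m hm => ?_⟩
      rw [Set.mem_inv_smul_set_iff]
      exact hm
    obtain ⟨t, ht⟩ := hL.isClosed.isCompact.elim_finite_subcover _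
      (fun x => ultrafilter_isOpen_basic _) hcover
    have hT : ∀ r ∈ L, (⋃ x ∈ t, x • A) ∈ r := fun r hr => by
      obtain ⟨x, hx, hxr⟩ := Set.mem_iUnion₂.1 (ht hr)
      exact mem_of_superset hxr (Set.subset_biUnion_of_mem (u := fun x => x • A) hx)
    obtain ⟨x, hx⟩ :=
      (isSmall_biUnion_smul hA t _ isLarge_univ).exists_eventually_mul_mem q
    have hx' : ∀ᶠ m in (q : Filter G), x * m ∈ ⋃ x ∈ t, x • A :=
      (eventually_pure_mul x q (· ∈ _)).1 (hT _ (hL.mul_mem (pure x) q hq))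
    obtain ⟨m, hm, hm'⟩ := (hx.and hx').exists
    exact hm.2 hm'
  · intro h B hB
    by_contra hBA
    -- As `B \ A` is not large, the complements of its translates have the finite intersection
    -- property, so this closed left ideal is nonempty.
    let C : Set (Ultrafilter G) := {q | ∀ x : G, ∀ᶠ m in (q : Filter G), x * m ∉ B \ A}
    have hC : IsClosed C := by
      simp only [C, Set.ofPred_forall]
      exact isClosed_iInter fun x => ultrafilter_isClosed_basic {m | x * m ∉ B \ A}
    have hCmul : ∀ y, ∀ q ∈ C, y * q ∈ C := by
      intro y q hq x
      rw [Ultrafilter.eventually_mul]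
      exact Eventually.of_forall fun z => by simpa only [mul_assoc] using hq (x * z)
    have hCne : C.Nonempty := by
      have hfilter : (⨅ x : G, 𝓟 {m | x * m ∉ B \ A}).NeBot := by
        refine (hasBasis_iInf_principal_finite _).neBot_iff.2 fun {t} ht => ?_
        by_contra hempty
        refine hBA ⟨t⁻¹, ht.inv, Set.eq_univ_of_forall fun m => ?_⟩
        by_contra hm
        refine hempty ⟨m, Set.mem_iInter₂.2 fun x hx hxm => hm ?_⟩
        exact ⟨x⁻¹, Set.inv_mem_inv.2 hx, x * m, hxm, inv_mul_cancel_left x m⟩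
      exact ⟨Ultrafilter.of _, fun x => Ultrafilter.of_le _
        (mem_iInf_of_mem x (mem_principal_self _))⟩
    obtain ⟨L, hLC, hL⟩ := exists_isMinimalLeftIdeal_subset hC hCne hCmul
    obtain ⟨q, hq⟩ := hL.nonempty
    obtain ⟨x, hx⟩ := hB.exists_eventually_mul_mem q
    refine h L hL _ (hL.mul_mem (pure x) q hq) ?_
    refine (eventually_pure_mul x q (· ∈ A)).2 ?_
    filter_upwards [hx, hLC hq x] with m hm hm'
    by_contra hmA
    exact hm' ⟨hm, hmA⟩

/-- For an idempotent `e` and `g * e = e = g' * e`, `(e * g) * (e * g') = e * g'`. -/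
theorem exists_leftIdentity_family (G : Type*) [Group G] :
    ∃ E : Set (Ultrafilter G), (∀ e ∈ E, ∀ f ∈ E, e * f = f) ∧
      (∀ f ∈ E, ∃ L, IsMinimalLeftIdeal L ∧ f ∈ L) ∧
      ∀ L, IsMinimalLeftIdeal L → ∃ f ∈ E, f ∈ L := by
  obtain ⟨L₀, -, hL₀⟩ := exists_isMinimalLeftIdeal_subset (G := G) isClosed_univ
    ⟨pure 1, trivial⟩ (fun _ _ _ => trivial)
  obtain ⟨e, he, hee⟩ := exists_idempotent_in_compact_subsemigroup
    Ultrafilter.continuous_mul_left L₀ hL₀.nonempty hL₀.isClosed.isCompact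
    fun x _ y hy => hL₀.mul_mem x y hy
  refine ⟨{f | ∃ L, IsMinimalLeftIdeal L ∧ ∃ g ∈ L, g * e = e ∧ e * g = f}, ?_, ?_, ?_⟩
  · rintro _ ⟨_, -, g, -, hg, rfl⟩ _ ⟨_, -, g', -, -, rfl⟩
    rw [mul_assoc, ← mul_assoc g, hg, ← mul_assoc, hee]
  · rintro _ ⟨L, hL, g, hgL, -, rfl⟩
    exact ⟨L, hL, hL.mul_mem e g hgL⟩
  · intro L hL
    obtain ⟨q, hq⟩ := hL.nonempty
    -- Minimality of `L₀` gives `y * (q * e) = e`, so `g = y * q` works.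
    obtain ⟨y, hy⟩ := hL₀.exists_mul_eq (q * e) (hL₀.mul_mem q e he) e he
    have hyq := hL.mul_mem y q hq
    exact ⟨e * (y * q), ⟨L, hL, y * q, hyq, by rw [mul_assoc, hy], rfl⟩, hL.mul_mem e _ hyq⟩

end Translate

theorem mainTheorem3 (G : Type*) [Group G] :
    IsInvariantIdeal (smallSets G) ∧
      ∃ τ : TopologicalSpace G,
        @T2Space G τ ∧ @ExtremallyDisconnected G τ ∧ IsLeftInvariantTopology τ ∧
          smallSets G = {A : Set G | @IsNowhereDense G τ A} := by
  obtain ⟨E, hE, hEmin, hEmeet⟩ := exists_leftIdentity_family G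
  have hne : E.Nonempty := by
    obtain ⟨L, -, hL⟩ := exists_isMinimalLeftIdeal_subset (G := G) isClosed_univ
      ⟨pure 1, trivial⟩ (fun _ _ _ => trivial)
    obtain ⟨f, hf, -⟩ := hEmeet L hL
    exact ⟨f, hf⟩
  refine ⟨isInvariantIdeal_smallSets G, ultrafilterTopology E, t2Space_ultrafilterTopology hE hne,
    extremallyDisconnected_ultrafilterTopology hE hne,
    isLeftInvariantTopology_ultrafilterTopology E, Set.ext fun A => ?_⟩
  refine isSmall_iff_forall_notMem.trans
    (Iff.trans ?_ (isNowhereDense_ultrafilterTopology_iff hE hne A).symm)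
  constructor
  · intro h f hf
    obtain ⟨L, hL, hfL⟩ := hEmin f hf
    exact Set.eq_empty_of_forall_notMem fun x hx =>
      h L hL _ (hL.mul_mem (pure x) f hfL) ((eventually_pure_mul x f (· ∈ A)).2 hx)
  · intro h L hL q hq hAq
    obtain ⟨f, hf, hfL⟩ := hEmeet L hL
    obtain ⟨y, rfl⟩ := hL.exists_mul_eq f hfL q hq
    have hy : ∀ᶠ x in (y : Filter G), x ∈ ultrafilterShift f A := hAq
    obtain ⟨x, hx⟩ := hy.exists
    rwa [h f hf] at hx
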